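/- Let $(X,\|\cdot\|)$ be a real Banach space with topological dual $X^*$, and suppose that $X$ is Gâteaux smooth, i.e. its norm is Gâteaux differentiable on $X\setminus\{0\}$. For a set-valued mapping $T:X\rightrightarrows X^*$ put $\operatorname{dom}T=\{x: T(x)\neq\emptyset\}$ and $\operatorname{gph}T=\{(x,x^*): x^*\in T(x)\}$. Let $J(x)=\{x^*\in X^*:\ \langle x^*,x\rangle=\|x\|^2=\|x^*\|^2\}$ be the duality mapping. The operator $T$ is *monotone* if $\langle x_1^*-x_2^*,x_1-x_2\rangle\ge 0$ for all $(x_1,x_1^*),(x_2,x_2^*)\in\operatorname{gph}T$, and *maximal monotone* if it is monotone and $\operatorname{gph}T=\operatorname{gph}S$ for every monotone $S:X\rightrightarrows X^*$ with $\operatorname{gph}T\subset\operatorname{gph}S$. For $\sigma>0$, $T$ is *$\sigma$-strongly monotone* if $T-\sigma J$ is monotone, and *$\sigma$-strongly maximal monotone* if it is $\sigma$-strongly monotone and maximal monotone (i.e. maximal among all monotone operators). Let $\sigma>0$ and let $T:X\rightrightarrows X^*$ be $\sigma$-strongly monotone. Assume that either $X$ is reflexive, or the set $\operatorname{dom}T$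 is closed and convex. Then $T$ is $\sigma$-strongly maximal monotone if and only if $$\operatorname{gph}T=\operatorname{gph}S\quad\text{for every $\sigma$-strongly monotone } S:X\rightrightarrows X^*\text{ with }\operatorname{gph}T\subset\operatorname{gph}S .$$ -/

import Mathlib

namespace MonotoneOperators

open scoped Pointwise

/-- Graph of a set-valued mapping. -/
def gph {X Y : Type*} (F : X → Set Y) : Set (X × Y) :=
  {p | p.2 ∈ F p.1}

/-- Domain of a set-valued mapping. -/
def dom {X Y : Type*} (F : X → Set Y) : Set X :=
  {x | (F x).Nonempty}

/-- A real normed space is Gâteaux smooth if its norm is Gâteaux differentiable (with a bounded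
linear Gâteaux derivative) at every nonzero point. -/
def GateauxSmooth (X : Type*) [NormedAddCommGroup X] [NormedSpace ℝ X] : Prop :=
  ∀ x : X, x ≠ 0 → ∃ D : StrongDual ℝ X, ∀ v : X,
    HasLineDerivAt ℝ (fun y : X => ‖y‖) (D v) x v

/-- Reflexivity: the canonical embedding into the bidual is onto. -/
def Reflexive (X : Type*) [NormedAddCommGroup X] [NormedSpace ℝ X] : Prop :=
  Function.Surjective (NormedSpace.inclusionInDoubleDual ℝ X)

variable {X : Type*} [NormedAddCommGroup X] [NormedSpace ℝ X]

/-- The (normalized) duality mapping `J : X ⇉ X*`. -/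
def dualityMap (x : X) : Set (StrongDual ℝ X) :=
  {f | f x = ‖x‖ ^ 2 ∧ ‖f‖ ^ 2 = ‖x‖ ^ 2}

/-- Monotone set-valued operators `T : X ⇉ X*`. -/
def IsMonotone (T : X → Set (StrongDual ℝ X)) : Prop :=
  ∀ p ∈ gph T, ∀ q ∈ gph T, 0 ≤ (p.2 - q.2) (p.1 - q.1)

/-- Maximal monotone operators: monotone, and without a proper monotone extension. -/
def IsMaximalMonotone (T : X → Set (StrongDual ℝ X)) : Prop :=
  IsMonotone T ∧
    ∀ S : X → Set (StrongDual ℝ X), IsMonotone S → gph T ⊆ gph S → gph T = gph S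

/-- `T` is `σ`-strongly monotone if `T - σ J` is monotone. -/
def IsStronglyMonotone (σ : ℝ) (T : X → Set (StrongDual ℝ X)) : Prop :=
  IsMonotone (fun x => T x - σ • dualityMap x)

/-- `T` is `σ`-strongly maximal monotone if it is `σ`-strongly monotone and maximal among
all monotone operators. -/
def IsStronglyMaximalMonotone (σ : ℝ) (T : X → Set (StrongDual ℝ X)) : Prop :=
  IsStronglyMonotone σ T ∧ IsMaximalMonotone T

/-- Strong monotonicity written out as an inequality. -/
theorem isStronglyMonotone_iff (σ : ℝ) (T : X → Set (StrongDual ℝ X)) :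
    IsStronglyMonotone σ T ↔
      ∀ x₁ x₂ : X, ∀ f₁ ∈ T x₁, ∀ f₂ ∈ T x₂, ∀ j₁ ∈ dualityMap x₁, ∀ j₂ ∈ dualityMap x₂,
        σ * (j₁ - j₂) (x₁ - x₂) ≤ (f₁ - f₂) (x₁ - x₂) := by
  constructor
  · intro h x₁ x₂ f₁ hf₁ f₂ hf₂ j₁ hj₁ j₂ hj₂
    have := h (x₁, f₁ - σ • j₁) (Set.sub_mem_sub hf₁ (Set.smul_mem_smul_set hj₁))
      (x₂, f₂ - σ • j₂) (Set.sub_mem_sub hf₂ (Set.smul_mem_smul_set hj₂))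
    simp only [sub_apply, smul_apply, smul_eq_mul] at this ⊢
    linarith
  · rintro h ⟨x₁, _⟩ ⟨f₁, hf₁, _, ⟨j₁, hj₁, rfl⟩, rfl⟩ ⟨x₂, _⟩ ⟨f₂, hf₂, _, ⟨j₂, hj₂, rfl⟩, rfl⟩
    have := h x₁ x₂ f₁ hf₁ f₂ hf₂ j₁ hj₁ j₂ hj₂
    simp only [sub_apply, smul_apply, smul_eq_mul] at this ⊢
    linarith

end MonotoneOperators

/-! Put `A = T - σJ`. A `σ`-strongly monotone operator is monotone because `J` is, so maximality
among monotone operators trivially gives maximality among strongly monotone ones. Conversely,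
Gâteaux smoothness makes `J` single-valued, so adding a point to `A` amounts to adding one to `T`;
hence `A` is maximal monotone, and what remains is a sum theorem: `A + σJ` is maximal monotone. If
the domain is closed and convex, a Bishop–Phelps normal forces the base point `x₀` of any related
pair into the domain, and differentiating `‖·‖²/2` at `x₀` along segments in the domain finishes
(`mem_of_related_of_closed_convex`). If `X` is reflexive, Fenchel duality applied to `A` and a
convex function penalised by `‖x - x₀‖²/2` yields a point of `gph A`, and relatedness forces that
point to lie over `x₀` (`mem_of_related_of_reflexive`). -/

namespace MonotoneOperators

open Filter Topology
open scoped Pointwise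

/-! ### Ekeland's principle. -/

/-- A nonstrict form of **Ekeland's variational principle**. -/
theorem exists_forall_le_add_dist {M : Type*} [MetricSpace M] [CompleteSpace M] [Nonempty M]
    {φ : M → ℝ} (hφ : Continuous φ) (hb : BddBelow (Set.range φ)) {ε : ℝ} (hε : 0 < ε) :
    ∃ y, ∀ z, φ y ≤ φ z + ε * dist z y := by
  -- Each step closes at least half of the gap between `φ y` and the infimum of `φ` over the Ekeland
  -- set of `y`. A point violating the conclusion at the limit lies in all these sets, which
  -- contradicts the halving.
  have key : ∀ y, ∃ y', φ y' + ε * dist y' y ≤ φ y ∧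
      ∀ z, φ z + ε * dist z y ≤ φ y → 2 * φ y' ≤ φ z + φ y := by
    intro y
    set s : Set ℝ := φ '' {z | φ z + ε * dist z y ≤ φ y} with hs
    have hsb : BddBelow s := hb.mono (Set.image_subset_range _ _)
    have hne : s.Nonempty := ⟨φ y, y, by simp, rfl⟩
    rcases le_or_gt (φ y) (sInf s) with h | h
    · refine ⟨y, by simp, fun z hz => ?_⟩
      have := csInf_le hsb ⟨z, hz, rfl⟩
      linarith
    · obtain ⟨_, ⟨y', hy', rfl⟩, hlt⟩ :=
        exists_lt_of_csInf_lt hne (show sInf s < (sInf s + φ y) / 2 by linarith)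
      refine ⟨y', hy', fun z hz => ?_⟩
      have := csInf_le hsb ⟨z, hz, rfl⟩
      linarith
  choose next h₁ h₂ using key
  obtain ⟨y₀⟩ := ‹Nonempty M›
  let u : ℕ → M := fun n => next^[n] y₀
  have hu : ∀ n, u (n + 1) = next (u n) := fun n => Function.iterate_succ_apply' next n y₀
  have hle : ∀ n k, φ (u (n + k)) + ε * dist (u (n + k)) (u n) ≤ φ (u n) := by
    intro n k
    induction k with
    | zero => simp
    | succ k ih =>
      have h := h₁ (u (n + k))
      rw [← hu, add_assoc] at h
      have := mul_le_mul_of_nonneg_left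
        (dist_triangle (u (n + (k + 1))) (u (n + k)) (u n)) hε.le
      linarith
  have hanti : Antitone (fun n => φ (u n)) := by
    refine antitone_nat_of_succ_le fun n => ?_
    have := hle n 1
    have : 0 ≤ ε * dist (u (n + 1)) (u n) := by positivity
    linarith
  have hlim : Tendsto (fun n => φ (u n)) atTop (𝓝 (⨅ n, φ (u n))) :=
    tendsto_atTop_ciInf hanti (hb.mono (by rintro _ ⟨n, rfl⟩; exact ⟨u n, rfl⟩))
  have hcauchy : CauchySeq u := by
    rw [Metric.cauchySeq_iff']
    intro δ hδ
    obtain ⟨N, hN⟩ := (hlim.eventually (gt_mem_nhds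
      (show (⨅ n, φ (u n)) < (⨅ n, φ (u n)) + ε * δ by linarith [mul_pos hε hδ]))).exists
    refine ⟨N, fun n hn => ?_⟩
    obtain ⟨k, rfl⟩ := Nat.exists_eq_add_of_le hn
    have h3 := hle N k
    have h4 := hanti.le_of_tendsto hlim (N + k)
    exact lt_of_mul_lt_mul_left (by linarith) hε.le
  obtain ⟨y, hy⟩ := cauchySeq_tendsto_of_complete hcauchy
  have hφy : Tendsto (fun n => φ (u n)) atTop (𝓝 (φ y)) := (hφ.tendsto y).comp hy
  have hmem : ∀ n, φ y + ε * dist y (u n) ≤ φ (u n) := by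
    intro n
    have h1 : Tendsto (fun k => φ (u (k + n)) + ε * dist (u (k + n)) (u n)) atTop
        (𝓝 (φ y + ε * dist y (u n))) :=
      (hφy.comp (tendsto_add_atTop_nat n)).add
        (((hy.comp (tendsto_add_atTop_nat n)).dist tendsto_const_nhds).const_mul ε)
    refine le_of_tendsto h1 (Eventually.of_forall fun k => ?_)
    rw [add_comm k n]
    exact hle n k
  refine ⟨y, fun z => ?_⟩
  by_contra! hz
  have hz' : ∀ n, 2 * φ (u (n + 1)) ≤ φ z + φ (u n) := by
    intro n
    rw [hu]
    apply h₂
    have := mul_le_mul_of_nonneg_left (dist_triangle z y (u n)) hε.le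
    linarith [hmem n]
  have h5 : 2 * φ y ≤ φ z + φ y :=
    le_of_tendsto_of_tendsto' ((hφy.comp (tendsto_add_atTop_nat 1)).const_mul 2)
      (hφy.const_add (φ z)) hz'
  have : 0 ≤ ε * dist z y := by positivity
  linarith

theorem deriv_nonneg_of_nonneg_right {k : ℝ → ℝ} {d δ : ℝ} (hk : HasDerivAt k d 0)
    (h0 : k 0 = 0) (hδ : 0 < δ) (hpos : ∀ t, 0 < t → t < δ → 0 ≤ k t) : 0 ≤ d := by
  have h := hk.hasDerivWithinAt (s := Set.Ioi 0)
  rw [hasDerivWithinAt_iff_tendsto_slope' (by simp)] at h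
  refine ge_of_tendsto h ?_
  filter_upwards [Ioo_mem_nhdsGT hδ] with t ht
  rw [slope_def_field, h0, sub_zero, sub_zero]
  exact div_nonneg (hpos t ht.1 ht.2) ht.1.le

/-! ### Support points of closed convex sets. -/

section Support

variable {X : Type*} [NormedAddCommGroup X] [NormedSpace ℝ X] [CompleteSpace X]

/-- **Bishop–Phelps**: a point outside a closed convex set is strictly separated from it by a
supporting hyperplane. -/
theorem exists_support_point {D : Set X} (hD : IsClosed D) (hconv : Convex ℝ D)
    (hne : D.Nonempty) {x₀ : X} (hx₀ : x₀ ∉ D) :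
    ∃ y ∈ D, ∃ n : StrongDual ℝ X, (∀ z ∈ D, n z ≤ n y) ∧ n y < n x₀ := by
  have : CompleteSpace D := hD.completeSpace_coe
  have : Nonempty D := hne.to_subtype
  obtain ⟨⟨y, hyD⟩, hy⟩ := exists_forall_le_add_dist (M := D) (φ := fun z => ‖(z : X) - x₀‖)
    (by fun_prop) ⟨0, by rintro _ ⟨z, rfl⟩; exact norm_nonneg _⟩ (show (0 : ℝ) < 1 / 2 by norm_num)
  have hpos : 0 < ‖y - x₀‖ := norm_pos_iff.2 (sub_ne_zero.2 fun h => hx₀ (h ▸ hyD))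
  -- Ekeland's inequality says exactly that this convex set misses `D`. As the slope `1/2` is less
  -- than 1, it contains `x₀` and the open segment from `y` to `x₀`, so `y` lies in its closure and
  -- a separating functional supports `D` at `y`.
  let C : Set X := {w | dist w x₀ + 1 / 2 * dist w y < ‖y - x₀‖}
  have hCconv : Convex ℝ C := by
    have h := (convexOn_univ_dist x₀).add
      ((convexOn_univ_dist y).smul (show (0 : ℝ) ≤ 1 / 2 by norm_num))
    have h' := h.convex_lt ‖y - x₀‖
    simpa [C] using h'
  have hCopen : IsOpen C := isOpen_lt (by fun_prop) continuous_const
  have hdisj : Disjoint C D := by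
    rw [Set.disjoint_left]
    intro w hw hwD
    have h := hy ⟨w, hwD⟩
    simp only [Subtype.dist_eq] at h
    rw [← dist_eq_norm w x₀] at h
    exact absurd hw (not_lt.2 h)
  obtain ⟨f, u, hfC, hfD⟩ := geometric_hahn_banach_open hCconv hCopen hconv hdisj
  have hx₀C : x₀ ∈ C := by
    simp only [C, Set.mem_ofPred_eq, dist_self, dist_comm x₀ y, dist_eq_norm y x₀]
    linarith
  have hseg : ∀ t : ℝ, 0 < t → t < 1 → 0 ≤ t * (u - f y - (f x₀ - f y)) + (1 - t) * (u - f y) := by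
    intro t ht ht1
    have hmem : y + t • (x₀ - y) ∈ C := by
      simp only [C, Set.mem_ofPred_eq, dist_eq_norm]
      rw [show y + t • (x₀ - y) - x₀ = (1 - t) • (y - x₀) by module,
        show y + t • (x₀ - y) - y = (-t) • (y - x₀) by module, norm_smul, norm_smul,
        Real.norm_of_nonneg (by linarith), norm_neg, Real.norm_of_nonneg ht.le]
      nlinarith
    have := hfC _ hmem
    simp only [map_add, map_smul, map_sub, smul_eq_mul] at this
    linarith
  have hu : f y ≤ u := by
    have hlim : Tendsto (fun t : ℝ => t * (u - f y - (f x₀ - f y)) + (1 - t) * (u - f y))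
        (𝓝[>] 0) (𝓝 (0 * (u - f y - (f x₀ - f y)) + (1 - 0) * (u - f y))) :=
      (Continuous.tendsto (by fun_prop) 0).mono_left nhdsWithin_le_nhds
    have := ge_of_tendsto hlim (by
      filter_upwards [Ioo_mem_nhdsGT (zero_lt_one (α := ℝ))] with t ht using hseg t ht.1 ht.2)
    linarith
  refine ⟨y, hyD, -f, fun z hz => ?_, ?_⟩
  · simpa using hu.trans (hfD z hz)
  · simpa using (hfC _ hx₀C).trans_le (hfD y hyD)

end Support

/-! ### The duality map as the derivative of half the squared norm. -/

section Duality

variable {X : Type*} [NormedAddCommGroup X] [NormedSpace ℝ X]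

theorem dualityMap_nonempty (x : X) : (dualityMap x).Nonempty := by
  by_cases hx : ‖x‖ = 0
  · exact ⟨0, by simp [dualityMap, hx]⟩
  · obtain ⟨g, hg, hgx⟩ := exists_dual_vector ℝ x hx
    refine ⟨‖x‖ • g, ?_, ?_⟩
    · simp only [smul_apply, hgx, smul_eq_mul, RCLike.ofReal_real_eq_id, id]
      ring
    · simp [norm_smul, hg]

/-- Young's inequality, with equality for `f ∈ dualityMap x`; this makes such an `f` a subgradient
of `‖·‖²/2` at `x`. -/
theorem apply_le_half_sq (f : StrongDual ℝ X) (x : X) : f x ≤ ‖f‖ ^ 2 / 2 + ‖x‖ ^ 2 / 2 := by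
  have h1 := (le_abs_self _).trans (f.le_opNorm x)
  nlinarith [sq_nonneg (‖f‖ - ‖x‖)]

theorem dualityMap_monotone {x y : X} {j k : StrongDual ℝ X} (hj : j ∈ dualityMap x)
    (hk : k ∈ dualityMap y) : 0 ≤ (j - k) (x - y) := by
  have h1 := apply_le_half_sq j y
  have h2 := apply_le_half_sq k x
  obtain ⟨a, b⟩ := hj
  obtain ⟨c, d⟩ := hk
  simp only [sub_apply, map_sub]
  linarith

/-- The derivative exists by smoothness (at the origin the function is a multiple of `t²`), and
subtracting the subgradient `j` leaves a function minimal at `0`, which identifies it. -/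
theorem GateauxSmooth.hasDerivAt (hX : GateauxSmooth X) {x : X} {j : StrongDual ℝ X}
    (hj : j ∈ dualityMap x) (v : X) :
    HasDerivAt (fun t : ℝ => ‖x + t • v‖ ^ 2 / 2) (j v) 0 := by
  have hex : ∃ d, HasDerivAt (fun t : ℝ => ‖x + t • v‖ ^ 2 / 2) d 0 := by
    by_cases hx : x = 0
    · subst hx
      refine ⟨_, ((hasDerivAt_pow 2 (0 : ℝ)).mul_const (‖v‖ ^ 2 / 2)).congr_of_eventuallyEq
        (Eventually.of_forall fun t => ?_)⟩
      simp only [zero_add, norm_smul, mul_pow, Real.norm_eq_abs, sq_abs]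
      ring
    · obtain ⟨D, hD⟩ := hX x hx
      exact ⟨_, ((hD v).pow 2).div_const 2⟩
  obtain ⟨d, hd⟩ := hex
  have hsub : HasDerivAt (fun t : ℝ => ‖x + t • v‖ ^ 2 / 2 - t * j v) (d - 1 * j v) 0 :=
    hd.sub ((hasDerivAt_id (0 : ℝ)).mul_const (j v))
  have hmin : IsLocalMin (fun t : ℝ => ‖x + t • v‖ ^ 2 / 2 - t * j v) 0 := by
    refine Eventually.of_forall fun t => ?_
    have h := apply_le_half_sq j (x + t • v)
    obtain ⟨a, b⟩ := hj
    simp only [map_add, map_smul, smul_eq_mul] at h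
    simp only [zero_smul, add_zero, zero_mul, sub_zero]
    linarith
  have := hmin.hasDerivAt_eq_zero hsub
  rwa [show j v = d by linarith]

theorem GateauxSmooth.dualityMap_subsingleton (hX : GateauxSmooth X) (x : X) :
    (dualityMap x).Subsingleton := by
  intro j hj k hk
  ext v
  exact (hX.hasDerivAt hj v).unique (hX.hasDerivAt hk v)

/-! ### The sum theorem for closed convex domains. -/

/-- If `A` is maximal monotone with closed convex domain, any `(x₀, f₀)` monotonically related to
`A + σ J` belongs to its graph. -/
theorem mem_of_related_of_closed_convex [CompleteSpace X] (hX : GateauxSmooth X) {σ : ℝ}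
    (hσ : 0 < σ) {A : X → Set (StrongDual ℝ X)} (hA : IsMonotone A)
    (hmax : ∀ x f, (∀ y, ∀ b ∈ A y, 0 ≤ (b - f) (y - x)) → f ∈ A x)
    (hcl : IsClosed (dom A)) (hconv : Convex ℝ (dom A)) {x₀ : X} {f₀ j₀ : StrongDual ℝ X}
    (hj₀ : j₀ ∈ dualityMap x₀)
    (hrel : ∀ y, ∀ b ∈ A y, ∀ j ∈ dualityMap y, 0 ≤ (b + σ • j - f₀) (y - x₀)) :
    f₀ - σ • j₀ ∈ A x₀ := by
  have hne : (dom A).Nonempty := by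
    by_contra hne
    rw [Set.not_nonempty_iff_eq_empty] at hne
    have h : (0 : StrongDual ℝ X) ∈ A 0 := hmax 0 0 fun y b hb =>
      absurd (show y ∈ dom A from ⟨b, hb⟩) (by simp [hne])
    exact absurd (show (0 : X) ∈ dom A from ⟨0, h⟩) (by simp [hne])
  have hx₀ : x₀ ∈ dom A := by
    by_contra hx₀
    obtain ⟨y, ⟨a, ha⟩, n, hn, hlt⟩ := exists_support_point hcl hconv hne hx₀
    obtain ⟨j, hj⟩ := dualityMap_nonempty y
    -- The values of a maximal monotone operator recede along normals to its domain. A large `s`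
    -- then violates `hrel`, since `n (y - x₀) < 0`.
    have hray : ∀ s : ℝ, 0 ≤ s → a + s • n ∈ A y := by
      intro s hs
      refine hmax _ _ fun w b hb => ?_
      have h1 := hA (w, b) hb (y, a) ha
      have h2 := mul_le_mul_of_nonneg_left (hn w ⟨b, hb⟩) hs
      simp only [sub_apply, add_apply, smul_apply, map_sub, smul_eq_mul] at h1 ⊢
      linarith
    set c := (a + σ • j - f₀) (y - x₀) with hc
    have hd : 0 < n x₀ - n y := sub_pos.2 hlt
    have h := hrel y _ (hray ((|c| + 1) / (n x₀ - n y)) (by positivity)) j hj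
    have h3 : (|c| + 1) / (n x₀ - n y) * (n x₀ - n y) = |c| + 1 := by field_simp
    have h4 := le_abs_self c
    rw [show a + ((|c| + 1) / (n x₀ - n y)) • n + σ • j - f₀ =
      (a + σ • j - f₀) + ((|c| + 1) / (n x₀ - n y)) • n by abel, add_apply, ← hc] at h
    simp only [smul_apply, map_sub, smul_eq_mul] at h
    linarith
  refine hmax _ _ fun y b hb => ?_
  set v := y - x₀ with hv
  have hd := hX.hasDerivAt hj₀ v
  -- For `j` in the duality map at `x₀ + t • v`, the subgradient inequality bounds `t * j v` by the
  -- increment of `‖·‖²/2` from `x₀ + t • v` to `x₀ + (2 * t) • v`. Thus differentiability at `x₀`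
  -- alone suffices, without continuity of `J`.
  have hd2 : HasDerivAt (fun t : ℝ => ‖x₀ + (2 * t) • v‖ ^ 2 / 2) (j₀ v * (2 * 1)) 0 :=
    HasDerivAt.comp (h₂ := fun t : ℝ => ‖x₀ + t • v‖ ^ 2 / 2) (0 : ℝ) (by simpa using hd)
      ((hasDerivAt_id (0 : ℝ)).const_mul 2)
  have hk : HasDerivAt (fun t : ℝ => t * (b - f₀) v +
      σ * (‖x₀ + (2 * t) • v‖ ^ 2 / 2 - ‖x₀ + t • v‖ ^ 2 / 2))
      (1 * (b - f₀) v + σ * (j₀ v * (2 * 1) - j₀ v)) 0 :=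
    ((hasDerivAt_id (0 : ℝ)).mul_const _).add ((hd2.sub hd).const_mul σ)
  have h := deriv_nonneg_of_nonneg_right hk (by simp) one_pos ?_
  · simp only [sub_apply, smul_apply, smul_eq_mul] at h ⊢
    linarith
  intro t ht ht1
  obtain ⟨a, ha⟩ : x₀ + t • v ∈ dom A :=
    hconv.add_smul_sub_mem hx₀ ⟨b, hb⟩ ⟨ht.le, ht1.le⟩
  obtain ⟨j, hj⟩ := dualityMap_nonempty (x₀ + t • v)
  have h1 := hA (y, b) hb (_, a) ha
  have h2 := hrel _ a ha j hj
  have h3 := apply_le_half_sq j (x₀ + (2 * t) • v)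
  rw [show x₀ + (2 * t) • v = (x₀ + t • v) + t • v by module, map_add, hj.1, hj.2] at h3
  rw [show x₀ + (2 * t) • v = (x₀ + t • v) + t • v by module]
  simp only [add_sub_cancel_left] at h2
  simp only [show y - (x₀ + t • v) = (1 - t) • v by rw [hv]; module] at h1
  simp only [sub_apply, add_apply, smul_apply, map_smul, smul_eq_mul] at h1 h2 h3 ⊢
  have h4 : 0 ≤ b v - a v := by
    by_contra! hneg
    nlinarith
  have h5 : 0 ≤ t * (b v - a v) := by positivity
  have h6 := mul_le_mul_of_nonneg_left h3 hσ.le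
  linarith

/-! ### The sum theorem in reflexive spaces. -/

theorem sq_norm_combo_le {E : Type*} [NormedAddCommGroup E] [NormedSpace ℝ E] (x y : E) {a b : ℝ}
    (ha : 0 ≤ a) (hb : 0 ≤ b) (hab : a + b = 1) :
    ‖a • x + b • y‖ ^ 2 ≤ a * ‖x‖ ^ 2 + b * ‖y‖ ^ 2 := by
  have h := (convexOn_univ_norm (E := E)).pow (fun _ _ => norm_nonneg _) 2
  simpa using h.2 (Set.mem_univ x) (Set.mem_univ y) ha hb hab

/-- Elements of the convex hull of `{(a, f, f a) | f ∈ A a}` lie above the duality product. -/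
theorem IsMonotone.apply_le_of_mem_convexHull {A : X → Set (StrongDual ℝ X)} (hA : IsMonotone A)
    {p : X × StrongDual ℝ X × ℝ}
    (hp : p ∈ convexHull ℝ {q : X × StrongDual ℝ X × ℝ | q.2.1 ∈ A q.1 ∧ q.2.2 = q.2.1 q.1}) :
    p.2.1 p.1 ≤ p.2.2 := by
  -- The monotonicity inequality is affine in each graph point separately, so it passes to the hull
  -- one variable at a time; pairing `p` with itself gives the claim.
  have half : ∀ (y : X) (g : StrongDual ℝ X) (c : ℝ),
      Convex ℝ {q : X × StrongDual ℝ X × ℝ | q.2.1 y + g q.1 ≤ q.2.2 + c} := by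
    intro y g c q hq r hr a b ha hb hab
    simp only [Set.mem_ofPred_eq, Prod.fst_add, Prod.snd_add, Prod.smul_fst, Prod.smul_snd,
      add_apply, smul_apply, map_add, map_smul, smul_eq_mul] at hq hr ⊢
    have h1 := mul_le_mul_of_nonneg_left hq ha
    have h2 := mul_le_mul_of_nonneg_left hr hb
    have h3 : c = a * c + b * c := by rw [← add_mul, hab, one_mul]
    linarith
  have h1 : ∀ y, ∀ g ∈ A y, p.2.1 y + g p.1 ≤ p.2.2 + g y := by
    intro y g hg
    refine convexHull_min ?_ (half y g (g y)) hp
    rintro ⟨x, f, r⟩ ⟨hf, hr⟩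
    have h := hA (x, f) hf (y, g) hg
    simp only [sub_apply, map_sub, Set.mem_ofPred_eq] at h hr hf ⊢
    linarith
  have h2 := convexHull_min (t := {q : X × StrongDual ℝ X × ℝ | q.2.1 p.1 + p.2.1 q.1 ≤
    q.2.2 + p.2.2}) ?_ (half p.1 p.2.1 p.2.2) hp
  · simp only [Set.mem_ofPred_eq] at h2
    linarith
  · rintro ⟨x, f, r⟩ ⟨hf, hr⟩
    have h := h1 x f hf
    simp only [Set.mem_ofPred_eq] at h hr ⊢
    linarith

/-- Fenchel duality for a maximal monotone `A` and the convex function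
`φ x = σ ‖x‖² / 2 + ‖x - x₀‖² / 2 - f₀ x` on a reflexive space: there is `k ∈ A z` with `-k` a
subgradient of `φ` at `z`. -/
theorem exists_mem_subgradient (hR : Reflexive X) {σ : ℝ} (hσ : 0 < σ)
    {A : X → Set (StrongDual ℝ X)} (hA : IsMonotone A)
    (hmax : ∀ x f, (∀ y, ∀ b ∈ A y, 0 ≤ (b - f) (y - x)) → f ∈ A x)
    (x₀ : X) (f₀ : StrongDual ℝ X) :
    ∃ z, ∃ k ∈ A z, ∀ x, σ * (‖z‖ ^ 2 / 2) + ‖z - x₀‖ ^ 2 / 2 - f₀ z + k z ≤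
      σ * (‖x‖ ^ 2 / 2) + ‖x - x₀‖ ^ 2 / 2 - f₀ x + k x := by
  -- Minimised over `f`, this is `φ x + φ*(-g)`, the conjugate being written as an infimal
  -- convolution. Fenchel–Young gives `-N x g f ≤ g x`, whereas the hull of `G` lies above the
  -- duality product; hence the two sets can be separated.
  let N : X → StrongDual ℝ X → StrongDual ℝ X → ℝ := fun x g f =>
    σ * (‖x‖ ^ 2 / 2) + σ⁻¹ * (‖f‖ ^ 2 / 2) + ‖x - x₀‖ ^ 2 / 2 + ‖f₀ - g - f‖ ^ 2 / 2
      + (f₀ - g - f) x₀ - f₀ x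
  let C : Set (X × StrongDual ℝ X × ℝ) := {p | ∃ f, p.2.2 < -N p.1 p.2.1 f}
  let G : Set (X × StrongDual ℝ X × ℝ) := {q | q.2.1 ∈ A q.1 ∧ q.2.2 = q.2.1 q.1}
  have hCopen : IsOpen C := by
    simp only [C, Set.ofPred_exists]
    exact isOpen_iUnion fun f => isOpen_lt (by fun_prop) (by fun_prop)
  have hCconv : Convex ℝ C := by
    rintro ⟨x, g, r⟩ ⟨f, hf⟩ ⟨x', g', r'⟩ ⟨f', hf'⟩ a b ha hb hab
    refine ⟨a • f + b • f', ?_⟩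
    have h1 := mul_le_mul_of_nonneg_left (sq_norm_combo_le x x' ha hb hab) hσ.le
    have h2 := mul_le_mul_of_nonneg_left (sq_norm_combo_le f f' ha hb hab) (inv_pos.2 hσ).le
    have h3 := sq_norm_combo_le (x - x₀) (x' - x₀) ha hb hab
    have h4 := sq_norm_combo_le (f₀ - g - f) (f₀ - g' - f') ha hb hab
    obtain rfl : b = 1 - a := by linarith
    rw [show a • (x - x₀) + (1 - a) • (x' - x₀) = a • x + (1 - a) • x' - x₀ by module] at h3
    rw [show a • (f₀ - g - f) + (1 - a) • (f₀ - g' - f') =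
      f₀ - (a • g + (1 - a) • g') - (a • f + (1 - a) • f') by module] at h4
    have h5 : a * r + (1 - a) * r' < a * (-N x g f) + (1 - a) * (-N x' g' f') := by
      simp only at hf hf'
      rcases ha.eq_or_lt with rfl | ha'
      · linarith
      · have := mul_lt_mul_of_pos_left hf ha'
        have := mul_le_mul_of_nonneg_left hf'.le hb
        linarith
    simp only [N, Prod.fst_add, Prod.snd_add, Prod.smul_fst, Prod.smul_snd,
      add_apply, sub_apply, smul_apply, map_add, map_smul, smul_eq_mul] at h5 ⊢
    linarith
  have hdisj : Disjoint C (convexHull ℝ G) := by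
    rw [Set.disjoint_left]
    rintro ⟨x, g, r⟩ ⟨f, hf⟩ hp
    have h1 : g x ≤ r := hA.apply_le_of_mem_convexHull hp
    have h2 := apply_le_half_sq (f₀ - g - f) (x - x₀)
    have h3 : f x ≤ σ * (‖x‖ ^ 2 / 2) + σ⁻¹ * (‖f‖ ^ 2 / 2) := by
      have h := mul_le_mul_of_nonneg_left (apply_le_half_sq (σ⁻¹ • f) x) hσ.le
      rw [norm_smul, Real.norm_of_nonneg (inv_pos.2 hσ).le, mul_pow] at h
      simp only [smul_apply, smul_eq_mul] at h
      have e1 : σ * (σ⁻¹ * f x) = f x := by field_simp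
      have e2 : σ * (σ⁻¹ ^ 2 * ‖f‖ ^ 2 / 2 + ‖x‖ ^ 2 / 2) =
        σ * (‖x‖ ^ 2 / 2) + σ⁻¹ * (‖f‖ ^ 2 / 2) := by field_simp; ring
      rwa [e1, e2] at h
    simp only [N, sub_apply, map_sub] at hf h2
    linarith
  obtain ⟨F, u, hFC, hFG⟩ :=
    geometric_hahn_banach_open hCconv hCopen (convex_convexHull ℝ G) hdisj
  obtain ⟨a₁, b₁, hb₁⟩ : ∃ x, (A x).Nonempty := by
    by_contra! hne
    have h : (0 : StrongDual ℝ X) ∈ A 0 := hmax 0 0 fun y b hb => by simp [hne] at hb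
    simp [hne] at h
  let κ : ℝ := F (0, 0, 1)
  have hF : ∀ x g r, F (x, g, r) = F (x, 0, 0) + F (0, g, 0) + r * κ := by
    intro x g r
    rw [← smul_eq_mul, ← map_smul, ← map_add, ← map_add]
    simp
  have hκ : 0 < κ := by
    have h1 := hFG (a₁, b₁, b₁ a₁) (subset_convexHull ℝ G ⟨hb₁, rfl⟩)
    have h2 := hFC (a₁, b₁, min (b₁ a₁) (-N a₁ b₁ 0) - 1)
      ⟨0, by have := min_le_right (b₁ a₁) (-N a₁ b₁ 0); simp only; linarith⟩
    rw [hF] at h1 h2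
    have h3 := min_le_left (b₁ a₁) (-N a₁ b₁ 0)
    by_contra! hneg
    nlinarith
  let k : StrongDual ℝ X :=
    -(κ⁻¹ • F.comp (ContinuousLinearMap.inl ℝ X (StrongDual ℝ X × ℝ)))
  -- Reflexivity turns the bidual component of the separating functional into a point `z`.
  obtain ⟨z, hz⟩ := hR (-(κ⁻¹ • F.comp ((ContinuousLinearMap.inr ℝ X (StrongDual ℝ X × ℝ)).comp
    (ContinuousLinearMap.inl ℝ (StrongDual ℝ X) ℝ))))
  have hk : ∀ x, F (x, 0, 0) = κ * (-k x) := by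
    intro x
    simp only [k, neg_apply, smul_apply,
      ContinuousLinearMap.comp_apply, ContinuousLinearMap.inl_apply, smul_eq_mul, neg_neg]
    rw [mul_inv_cancel_left₀ hκ.ne']
    rfl
  have hz' : ∀ g, F (0, g, 0) = κ * (-g z) := by
    intro g
    have h := DFunLike.congr_fun hz g
    rw [NormedSpace.dual_def] at h
    rw [h]
    simp only [neg_apply, smul_apply,
      ContinuousLinearMap.comp_apply, ContinuousLinearMap.inl_apply,
      ContinuousLinearMap.inr_apply, smul_eq_mul, neg_neg]
    rw [mul_inv_cancel_left₀ hκ.ne']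
  obtain ⟨β, rfl⟩ : ∃ β, u = κ * β := ⟨κ⁻¹ * u, (mul_inv_cancel_left₀ hκ.ne' u).symm⟩
  have hup : ∀ x g f, -k x - g z - N x g f ≤ β := by
    intro x g f
    have h : ∀ r < -N x g f, r ≤ β + k x + g z := by
      intro r hr
      have h1 := hFC (x, g, r) ⟨f, hr⟩
      rw [hF, hk, hz'] at h1
      have : κ * (-k x - g z + r) < κ * β := by linarith
      have := lt_of_mul_lt_mul_left this hκ.le
      linarith
    have := le_of_forall_lt_imp_le_of_dense h
    linarith
  have hlow : ∀ a, ∀ b ∈ A a, β ≤ b a - k a - b z := by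
    intro a b hb
    have h1 := hFG (a, b, b a) (subset_convexHull ℝ G ⟨hb, rfl⟩)
    rw [hF, hk, hz'] at h1
    exact le_of_mul_le_mul_left (by linarith) hκ
  obtain ⟨j, hj, hj'⟩ := dualityMap_nonempty z
  obtain ⟨i, hi, hi'⟩ := dualityMap_nonempty (z - x₀)
  have hsub : ∀ x, σ * (‖z‖ ^ 2 / 2) + ‖z - x₀‖ ^ 2 / 2 - f₀ z -
      (σ * (‖x‖ ^ 2 / 2) + ‖x - x₀‖ ^ 2 / 2 - f₀ x) - k x ≤ β := by
    intro x
    -- This choice makes `-g` a subgradient of `φ` at `z`, so `-g z - φ*(-g)` equals `φ z`.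
    have h := hup x (f₀ - σ • j - i) (σ • j)
    simp only [N] at h
    rw [show f₀ - (f₀ - σ • j - i) - σ • j = i by abel, hi', norm_smul, mul_pow, hj',
      Real.norm_eq_abs, sq_abs] at h
    have e : σ⁻¹ * (σ ^ 2 * ‖z‖ ^ 2 / 2) = σ * (‖z‖ ^ 2 / 2) := by field_simp
    rw [e] at h
    simp only [sub_apply, smul_apply, smul_eq_mul, hj] at h
    rw [map_sub] at hi
    linarith
  -- Taking `x = z` gives `-k z ≤ β`, so `hlow` becomes monotone relatedness of `(z, k)` to `A`.
  have hkz : k ∈ A z := by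
    refine hmax z k fun a b hb => ?_
    have h1 := hsub z
    have h2 := hlow a b hb
    simp only [sub_apply, map_sub]
    linarith
  refine ⟨z, k, hkz, fun x => ?_⟩
  have h1 := hsub x
  have h2 := hlow z k hkz
  linarith

/-- If `A` is maximal monotone on a reflexive space, any `(x₀, f₀)` monotonically related to
`A + σ J` belongs to its graph. -/
theorem mem_of_related_of_reflexive (hX : GateauxSmooth X) (hR : Reflexive X) {σ : ℝ}
    (hσ : 0 < σ) {A : X → Set (StrongDual ℝ X)} (hA : IsMonotone A)
    (hmax : ∀ x f, (∀ y, ∀ b ∈ A y, 0 ≤ (b - f) (y - x)) → f ∈ A x)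
    {x₀ : X} {f₀ j₀ : StrongDual ℝ X} (hj₀ : j₀ ∈ dualityMap x₀)
    (hrel : ∀ y, ∀ b ∈ A y, ∀ j ∈ dualityMap y, 0 ≤ (b + σ • j - f₀) (y - x₀)) :
    f₀ - σ • j₀ ∈ A x₀ := by
  obtain ⟨z, k, hk, hmin⟩ := exists_mem_subgradient hR hσ hA hmax x₀ f₀
  obtain ⟨j, hj⟩ := dualityMap_nonempty z
  obtain ⟨i, hi⟩ := dualityMap_nonempty (z - x₀)
  have hcrit : ∀ v, 0 ≤ σ * j v + i v + (k - f₀) v := by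
    intro v
    have hd : HasDerivAt (fun t : ℝ => σ * (‖z + t • v‖ ^ 2 / 2) + ‖z - x₀ + t • v‖ ^ 2 / 2
        + t * (k - f₀) v - (σ * (‖z‖ ^ 2 / 2) + ‖z - x₀‖ ^ 2 / 2))
        (σ * j v + i v + 1 * (k - f₀) v) 0 :=
      ((((hX.hasDerivAt hj v).const_mul σ).add (hX.hasDerivAt hi v)).add
        ((hasDerivAt_id (0 : ℝ)).mul_const _)).sub_const _
    have h := deriv_nonneg_of_nonneg_right hd (by simp) one_pos fun t _ _ => ?_
    · linarith
    have h := hmin (z + t • v)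
    rw [show z + t • v - x₀ = z - x₀ + t • v by abel] at h
    simp only [sub_apply, map_add, map_smul, smul_eq_mul] at h ⊢
    linarith
  -- Stationarity in the direction `x₀ - z` against `hrel` at `(z, k)` leaves `‖z - x₀‖² ≤ 0`, which
  -- comes from the penalty term.
  have hzx : z = x₀ := by
    have h1 := hrel z k hk j hj
    have h2 := hcrit (-(z - x₀))
    simp only [map_neg, hi.1] at h2
    simp only [add_apply, sub_apply, smul_apply, smul_eq_mul] at h1 h2
    have h3 : ‖z - x₀‖ ^ 2 = 0 := le_antisymm (by linarith) (sq_nonneg _)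
    exact sub_eq_zero.1 (norm_eq_zero.1 (pow_eq_zero_iff two_ne_zero |>.1 h3))
  subst hzx
  obtain rfl := hX.dualityMap_subsingleton z hj hj₀
  have hi0 : i = 0 := by
    have h := hi.2
    simpa using h
  have hkeq : f₀ - σ • j = k := by
    ext v
    have h1 := hcrit v
    have h2 := hcrit (-v)
    simp only [hi0, map_neg, zero_apply, sub_apply, smul_apply, smul_eq_mul] at h1 h2 ⊢
    linarith
  rwa [hkeq]

/-! ### Passing between `T` and `T - σJ`. -/

theorem mem_sub_smul_dualityMap_iff (hX : GateauxSmooth X) {σ : ℝ}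
    {T : X → Set (StrongDual ℝ X)} {x : X} {f j : StrongDual ℝ X} (hj : j ∈ dualityMap x) :
    f ∈ T x - σ • dualityMap x ↔ f + σ • j ∈ T x := by
  constructor
  · rintro ⟨g, hg, _, ⟨i, hi, rfl⟩, rfl⟩
    obtain rfl := hX.dualityMap_subsingleton x hi hj
    simpa using hg
  · intro h
    exact ⟨_, h, _, Set.smul_mem_smul_set hj, add_sub_cancel_right _ _⟩

theorem dom_sub_smul_dualityMap (σ : ℝ) (T : X → Set (StrongDual ℝ X)) :
    dom (fun x => T x - σ • dualityMap x) = dom T := by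
  ext x
  exact ⟨fun h => h.of_sub_left, fun h => h.sub (dualityMap_nonempty x).smul_set⟩

theorem IsStronglyMonotone.isMonotone {σ : ℝ} (hσ : 0 ≤ σ) {T : X → Set (StrongDual ℝ X)}
    (hT : IsStronglyMonotone σ T) : IsMonotone T := by
  rintro ⟨x, f⟩ hf ⟨y, g⟩ hg
  obtain ⟨j, hj⟩ := dualityMap_nonempty x
  obtain ⟨i, hi⟩ := dualityMap_nonempty y
  exact (mul_nonneg hσ (dualityMap_monotone hj hi)).trans
    ((isStronglyMonotone_iff σ T).1 hT x y f hf g hg j hj i hi)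

/-- Maximality of `T` among `σ`-strongly monotone operators makes `T - σ J` maximal monotone. -/
theorem mem_sub_of_related (hX : GateauxSmooth X) {σ : ℝ} {T : X → Set (StrongDual ℝ X)}
    (hT : IsStronglyMonotone σ T)
    (hmax : ∀ S : X → Set (StrongDual ℝ X), IsStronglyMonotone σ S → gph T ⊆ gph S →
      gph T = gph S)
    (x : X) (f : StrongDual ℝ X)
    (hrel : ∀ y, ∀ b ∈ T y - σ • dualityMap y, 0 ≤ (b - f) (y - x)) :
    f ∈ T x - σ • dualityMap x := by
  obtain ⟨j, hj⟩ := dualityMap_nonempty x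
  let S : X → Set (StrongDual ℝ X) := fun y => T y ∪ {g | y = x ∧ g = f + σ • j}
  have hS : ∀ y, ∀ b ∈ S y - σ • dualityMap y, b ∈ T y - σ • dualityMap y ∨ (y = x ∧ b = f) := by
    rintro y _ ⟨g, hg | ⟨rfl, rfl⟩, _, ⟨i, hi, rfl⟩, rfl⟩
    · exact Or.inl ⟨g, hg, _, Set.smul_mem_smul_set hi, rfl⟩
    · obtain rfl := hX.dualityMap_subsingleton y hi hj
      exact Or.inr ⟨rfl, add_sub_cancel_right _ _⟩
  have hSm : IsStronglyMonotone σ S := by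
    rintro ⟨y, b⟩ hb ⟨w, c⟩ hc
    rcases hS y b hb with hb' | ⟨rfl, rfl⟩ <;> rcases hS w c hc with hc' | ⟨rfl, rfl⟩
    · exact hT (y, b) hb' (w, c) hc'
    · exact hrel y b hb'
    · have h := hrel w c hc'
      simp only [sub_apply, map_sub] at h ⊢
      linarith
    · simp
  have heq := hmax S hSm fun p hp => Or.inl hp
  rw [mem_sub_smul_dualityMap_iff hX hj]
  have h : (x, f + σ • j) ∈ gph S := Or.inr ⟨rfl, rfl⟩
  rw [← heq] at h
  exact h

theorem isMaximalMonotone_of_related {T : X → Set (StrongDual ℝ X)} (hT : IsMonotone T)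
    (h : ∀ x f, (∀ y, ∀ b ∈ T y, 0 ≤ (b - f) (y - x)) → f ∈ T x) : IsMaximalMonotone T :=
  ⟨hT, fun _ hS hTS => hTS.antisymm fun p hp =>
    h p.1 p.2 fun y b hb => hS (y, b) (hTS (show (y, b) ∈ gph T from hb)) p hp⟩

/-- Under the stated hypotheses, maximality among monotone operators and maximality among
`σ`-strongly monotone operators coincide for a `σ`-strongly monotone operator. -/
theorem isStronglyMaximalMonotone_iff [CompleteSpace X]
    (hX : GateauxSmooth X)
    (σ : ℝ) (hσ : 0 < σ)
    (T : X → Set (StrongDual ℝ X))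
    (hT : IsStronglyMonotone σ T)
    (h : Reflexive X ∨
      (IsClosed (dom T) ∧ Convex ℝ (dom T))) :
    IsStronglyMaximalMonotone σ T ↔
      ∀ S : X → Set (StrongDual ℝ X), IsStronglyMonotone σ S →
        gph T ⊆ gph S →
          gph T = gph S := by
  constructor
  · rintro ⟨-, -, hmax⟩ S hS hTS
    exact hmax S (hS.isMonotone hσ.le) hTS
  intro hmax
  have hA := mem_sub_of_related hX hT hmax
  refine ⟨hT, isMaximalMonotone_of_related (hT.isMonotone hσ.le) fun x f hrel => ?_⟩
  obtain ⟨j, hj⟩ := dualityMap_nonempty x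
  have hrel' : ∀ y, ∀ b ∈ T y - σ • dualityMap y, ∀ i ∈ dualityMap y,
      0 ≤ (b + σ • i - f) (y - x) := fun y b hb i hi =>
    hrel y _ ((mem_sub_smul_dualityMap_iff hX hi).1 hb)
  have hmem : f - σ • j ∈ T x - σ • dualityMap x := by
    rcases h with hR | ⟨hcl, hconv⟩
    · exact mem_of_related_of_reflexive hX hR hσ hT hA hj hrel'
    · rw [← dom_sub_smul_dualityMap σ] at hcl hconv
      exact mem_of_related_of_closed_convex hX hσ hT hA hcl hconv hj hrel'
  simpa using (mem_sub_smul_dualityMap_iff hX hj).1 hmem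

end Duality

end MonotoneOperators

theorem mainTheorem7 {X : Type*} [NormedAddCommGroup X] [NormedSpace ℝ X] [CompleteSpace X]
    (hX : MonotoneOperators.GateauxSmooth X)
    (σ : ℝ) (hσ : 0 < σ)
    (T : X → Set (StrongDual ℝ X))
    (hT : MonotoneOperators.IsStronglyMonotone σ T)
    (h : MonotoneOperators.Reflexive X ∨
      (IsClosed (MonotoneOperators.dom T) ∧ Convex ℝ (MonotoneOperators.dom T))) :
    MonotoneOperators.IsStronglyMaximalMonotone σ T ↔
      ∀ S : X → Set (StrongDual ℝ X), MonotoneOperators.IsStronglyMonotone σ S →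
        MonotoneOperators.gph T ⊆ MonotoneOperators.gph S →
          MonotoneOperators.gph T = MonotoneOperators.gph S :=
  MonotoneOperators.isStronglyMaximalMonotone_iff hX σ hσ T hT h
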